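/- **Setting.** Let $c\ge 1$ be the number of labels and $n\ge 1$ the sample size. Let $\mathcal X$ be a measurable space (for instance $\mathcal X\subset\mathbb R^d$) and let $D$ be a probability distribution on $\mathcal X\times\{-1,+1\}^c$. For $y\in\{-1,+1\}^c$ put $Y^+=\{j: y_j=1\}$ and $Y^-=\{j:y_j=-1\}$. Let $\kappa:\mathcal X\times\mathcal X\to\mathbb R$ be a positive definite symmetric kernel with $\kappa(x,x)\le r^2$ for all $x\in\mathcal X$, where $r>0$. Let $\phi:\mathcal X\to\mathbb H$ be a (strongly) measurable feature map of $\kappa$ into a real Hilbert space, i.e. $\kappa(x,x')=\langle\phi(x),\phi(x')\rangle$; for instance, $\mathbb H$ is the reproducing kernel Hilbert space of $\kappa$. For $\Lambda\in\mathbb R$ let $$\mathcal F=\Big\{x\mapsto(\langle w_1,\phi(x)\rangle,\dots,\langle w_c,\phi(x)\rangle)\;:\;w_1,\dots,w_c\in\mathbb H,\ \big(\textstyle\sum_{j=1}^c\|w_j\|^2\big)^{1/2}\le\Lambda\Big\}.$$ Let $\ell:\mathbb R\to\mathbb R$ be a $\rho$-Lipschitz base loss that dominates the $0/1$ loss, i.e.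 $\ell(u)\ge[\![u\le 0]\!]$ for all $u$, and that is bounded by $B$ on the arguments that occur: $\ell(f_p(x)-f_q(x))\le B$ for all $f\in\mathcal F$, $x\in\mathcal X$, $p,q\in\{1,\dots,c\}$ (in particular this holds if $\ell\le B$ everywhere). For a prediction $s\in\{-1,+1\}^c$, a score vector $v\in\mathbb R^c$ and a true label vector $y$ define $$L_h^{0/1}(s,y)=\frac1c\sum_{j=1}^c[\![s_j\ne y_j]\!],\qquad L_r^{0/1}(v,y)=\frac{1}{|Y^+||Y^-|}\sum_{p\in Y^+}\sum_{q\in Y^-}[\![v_p\le v_q]\!],\qquad L_r(v,y)=\frac{1}{|Y^+||Y^-|}\sum_{p\in Y^+}\sum_{q\in Y^-}\ell(v_p-v_q),$$ where both ranking losses are $0$ if $Y^+$ or $Y^-$ is empty. A threshold $T\in\mathbb R$ turns $v$ into the prediction that is $+1$ at $j$ if $v_j\ge T$ and $-1$ otherwise. Let $t^*$ be an oracle optimal thresholding function: for every score vector $v$ and every true label vector $y$, $t^*(v)=t^*(v,y)$ is the prediction given by some threshold, and no threshold gives a smaller Hamming loss $L_h^{0/1}(\cdot,y)$. For $f\in\mathcal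 F$ and a sample $S=((x_i,y_i))_{i=1}^n$ put $$R^h_{0/1}(t^*\circ f)=\mathbb E_{(x,y)\sim D}\,L_h^{0/1}(t^*(f(x)),y),\qquad R^r_{0/1}(f)=\mathbb E_{(x,y)\sim D}\,L_r^{0/1}(f(x),y),\qquad \hat R^r_S(f)=\frac1n\sum_{i=1}^nL_r(f(x_i),y_i).$$ **Theorem.** For every $f\in\mathcal F$ the two expectations above are well defined (the integrands are integrable). For every $\delta>0$, with probability at least $1-\delta$ over an i.i.d. sample $S$ of size $n$ from $D$, the following holds for all $f\in\mathcal F$ simultaneously: $$R^h_{0/1}(t^*\circ f)\;\le\; c\,R^r_{0/1}(f)\;\le\; c\,\hat R^r_S(f)+2\sqrt2\,\rho\sqrt{\frac{c^3\Lambda^2r^2}{n}}+3Bc\sqrt{\frac{\log\frac2\delta}{2n}}.$$ -/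

import Mathlib

open MeasureTheory
open scoped NNReal ENNReal

noncomputable section

namespace MultiLabel

/-- Label vectors in `{-1, +1}^c`; `ℤˣ` is the two-element set `{1, -1}`. -/
abbrev Labels (c : ℕ) : Type := Fin c → ℤˣ

/-- Every subset of `{-1, +1}` is measurable. -/
instance instDiscreteMeasurableSpaceSign : DiscreteMeasurableSpace ℤˣ :=
  ⟨fun s => ⟨Units.val '' s, trivial, Set.preimage_image_eq s Units.val_injective⟩⟩

/-- The set `Y⁺` of relevant labels. -/
def relevant {c : ℕ} (y : Labels c) : Finset (Fin c) := Finset.univ.filter fun j => y j = 1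

/-- The set `Y⁻` of irrelevant labels. -/
def irrelevant {c : ℕ} (y : Labels c) : Finset (Fin c) := Finset.univ.filter fun j => y j = -1

/-- The (0/1) Hamming loss of a predicted label vector `s`. -/
def hammingLoss {c : ℕ} (s y : Labels c) : ℝ :=
  (1 / (c : ℝ)) * ∑ j, if s j ≠ y j then (1 : ℝ) else 0

/-- The (0/1) ranking loss of a score vector `v`. If `Y⁺` or `Y⁻` is empty, the sum is empty and
the loss is `0`. -/
def rankingLoss {c : ℕ} (v : Fin c → ℝ) (y : Labels c) : ℝ :=
  (1 / (((relevant y).card : ℝ) * ((irrelevant y).card : ℝ))) *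
    ∑ p ∈ relevant y, ∑ q ∈ irrelevant y, if v p ≤ v q then (1 : ℝ) else 0

/-- The surrogate ranking loss of a score vector `v` with base loss `ℓ` (again `0` if `Y⁺` or `Y⁻`
is empty). -/
def surrogateRankingLoss {c : ℕ} (ℓ : ℝ → ℝ) (v : Fin c → ℝ) (y : Labels c) : ℝ :=
  (1 / (((relevant y).card : ℝ) * ((irrelevant y).card : ℝ))) *
    ∑ p ∈ relevant y, ∑ q ∈ irrelevant y, ℓ (v p - v q)

/-- The prediction obtained from the scores `v` with the threshold `T`: label `j` is predicted
relevant iff `v j ≥ T`. -/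
def threshold {c : ℕ} (T : ℝ) (v : Fin c → ℝ) : Labels c := fun j => if T ≤ v j then 1 else -1

/-- `t` is an oracle optimal thresholding function: for each score vector `v` and true label vector
`y`, the prediction `t v y` is obtained by thresholding `v` at some value, and no threshold value
gives a smaller Hamming loss. -/
def IsOracleThreshold {c : ℕ} (t : (Fin c → ℝ) → Labels c → Labels c) : Prop :=
  ∀ v y, (∃ T : ℝ, t v y = threshold T v) ∧
    ∀ T : ℝ, hammingLoss (t v y) y ≤ hammingLoss (threshold T v) y

/-- `κ` is a positive definite symmetric kernel: all its Gram matrices are symmetric and positive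
semidefinite. -/
def IsPDSKernel {X : Type*} (κ : X → X → ℝ) : Prop :=
  (∀ x x', κ x x' = κ x' x) ∧
    ∀ (m : ℕ) (x : Fin m → X) (a : Fin m → ℝ), 0 ≤ ∑ i, ∑ k, a i * a k * κ (x i) (x k)

/-- `φ` is a feature map of the kernel `κ`. The canonical map into the reproducing kernel Hilbert
space of `κ` is one. -/
def IsFeatureMap {X H : Type*} [NormedAddCommGroup H] [InnerProductSpace ℝ H]
    (κ : X → X → ℝ) (φ : X → H) : Prop :=
  ∀ x x', κ x x' = inner ℝ (φ x) (φ x')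

/-- The hypothesis set `{x ↦ (⟨w₁, φ x⟩, …, ⟨w_c, φ x⟩) : (∑ⱼ ‖wⱼ‖²)^(1/2) ≤ Λ}`. -/
def hypothesisSet {X H : Type*} [NormedAddCommGroup H] [InnerProductSpace ℝ H]
    (c : ℕ) (φ : X → H) (Λ : ℝ) : Set (X → Fin c → ℝ) :=
  {f | ∃ W : Fin c → H, Real.sqrt (∑ j, ‖W j‖ ^ 2) ≤ Λ ∧ ∀ x j, f x j = inner ℝ (W j) (φ x)}

/-- The expected risk of `f` for a loss `L` of scores and labels. -/
def expectedRisk {X : Type*} [MeasurableSpace X] {c : ℕ} (D : Measure (X × Labels c))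
    (L : (Fin c → ℝ) → Labels c → ℝ) (f : X → Fin c → ℝ) : ℝ :=
  ∫ z, L (f z.1) z.2 ∂D

/-- The empirical risk of `f` on the sample `S` for a loss `L` of scores and labels. -/
def empiricalRisk {X : Type*} {c n : ℕ} (S : Fin n → X × Labels c)
    (L : (Fin c → ℝ) → Labels c → ℝ) (f : X → Fin c → ℝ) : ℝ :=
  (1 / (n : ℝ)) * ∑ i, L (f (S i).1) (S i).2

end MultiLabel

end

/-! The first inequality holds pointwise. Threshold just above the highest-scored irrelevant label:
no irrelevant label is then predicted, and each missed relevant label forms a misordered pair with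
that label. Errors are thus at most misordered pairs, and `|Y⁺||Y⁻| ≤ c²` turns the normalisation
`1/c` into the factor `c` (`exists_hammingLoss_threshold_le`).

The second is a uniform deviation bound for the surrogate loss, which dominates the ranking loss.
McDiarmid's inequality reduces it to the expected supremum of the deviation, bounded in
`integral_iSup_inner_add_deviation_le`. There sample points are removed one at a time: each is
symmetrized, contracted to linear functionals, and absorbed into a vector `V` with both signs, so
the Rademacher average is never written out. The parallelogram law controls the growth of `‖V‖²`.

The contraction works because, with the weights viewed as one vector of `H^c`, a score difference
`f_p - f_q` is a single linear functional of norm at most `√2 r`, and the ranking loss averages over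
pairs. This costs no power of `c` (`surrogateRankingLoss_increment_le`). Suprema over finite
families keep measurability elementary; monotone limits give countable families, and a dense
sequence of weights gives all of `𝓕`. -/

namespace MultiLabel

/-! ### McDiarmid's inequality -/

section Concentration

variable {Z : Type*} [MeasurableSpace Z]

lemma measurePreserving_cons (D : Measure Z) [IsProbabilityMeasure D] (n : ℕ) :
    MeasurePreserving (fun p : Z × (Fin n → Z) => (Fin.cons p.1 p.2 : Fin (n + 1) → Z))
      (D.prod (Measure.pi fun _ : Fin n => D)) (Measure.pi fun _ : Fin (n + 1) => D) := by
  have h := (measurePreserving_piFinSuccAbove (fun _ : Fin (n + 1) => D) 0).symm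
  have he : (fun p : Z × (Fin n → Z) => (Fin.cons p.1 p.2 : Fin (n + 1) → Z)) =
      (MeasurableEquiv.piFinSuccAbove (fun _ : Fin (n + 1) => Z) 0).symm := by
    funext p
    simp [MeasurableEquiv.piFinSuccAbove, Fin.insertNthEquiv]
  rw [he]
  exact h

lemma integral_pi_succ (D : Measure Z) [IsProbabilityMeasure D] {n : ℕ}
    {g : (Fin (n + 1) → Z) → ℝ} (hg : Integrable g (Measure.pi fun _ : Fin (n + 1) => D)) :
    ∫ S, g S ∂(Measure.pi fun _ : Fin (n + 1) => D) =
      ∫ z, ∫ S, g (Fin.cons z S) ∂(Measure.pi fun _ : Fin n => D) ∂D := by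
  have hp := measurePreserving_cons D n
  rw [← hp.map_eq, integral_map hp.measurable.aemeasurable (hp.map_eq ▸ hg.aestronglyMeasurable),
    integral_prod]
  exact hp.integrable_comp_of_integrable hg

/-- The moment generating function bound behind McDiarmid's bounded differences inequality. -/
lemma integral_exp_le_of_bounded_differences (D : Measure Z) [IsProbabilityMeasure D]
    {b M : ℝ} (hb : 0 ≤ b) (t : ℝ) (n : ℕ) :
    ∀ g : (Fin n → Z) → ℝ, Measurable g → (∀ S, |g S| ≤ M) →
      (∀ S i z, g (Function.update S i z) - g S ≤ b) →
      ∫ S, Real.exp (t * g S) ∂(Measure.pi fun _ : Fin n => D) ≤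
        Real.exp (t * ∫ S, g S ∂(Measure.pi fun _ : Fin n => D) + n * ((b / 2) ^ 2 * t ^ 2 / 2)) := by
  have hexp : ∀ {Ω : Type _} [MeasurableSpace Ω] (μ : Measure Ω) [IsProbabilityMeasure μ]
      (f : Ω → ℝ), Measurable f → (∀ x, |f x| ≤ M) →
      Integrable (fun x => Real.exp (t * f x)) μ := by
    intro Ω _ μ _ f hf hfM
    refine Integrable.of_bound (by fun_prop) (Real.exp (|t| * M)) (ae_of_all _ fun x => ?_)
    rw [Real.norm_eq_abs, Real.abs_exp, Real.exp_le_exp]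
    calc t * f x ≤ |t * f x| := le_abs_self _
      _ = |t| * |f x| := abs_mul _ _
      _ ≤ |t| * M := by gcongr; exact hfM x
  induction n with
  | zero =>
    intro g _ _ _
    have : ∀ S, g S = g default := fun S => by rw [Subsingleton.elim S default]
    simp [this]
  | succ n ih =>
    intro g hg hgM hgb
    have hgc : Measurable fun p : Z × (Fin n → Z) => g (Fin.cons p.1 p.2) :=
      hg.comp (measurePreserving_cons D n).measurable
    have hgz : ∀ z, Measurable fun S : Fin n → Z => g (Fin.cons z S) :=
      fun z => hgc.comp measurable_prodMk_left
    have hgi : ∀ z, Integrable (fun S : Fin n → Z => g (Fin.cons z S))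
        (Measure.pi fun _ : Fin n => D) :=
      fun z => Integrable.of_bound (hgz z).aestronglyMeasurable M (ae_of_all _ fun S => hgM _)
    set G : Z → ℝ := fun z => ∫ S, g (Fin.cons z S) ∂(Measure.pi fun _ : Fin n => D) with hG
    have hGm : Measurable G := hgc.stronglyMeasurable.integral_prod_right.measurable
    have hGM : ∀ z, |G z| ≤ M := fun z => by
      simpa [hG] using norm_integral_le_of_norm_le_const (μ := Measure.pi fun _ : Fin n => D)
        (f := fun S => g (Fin.cons z S)) (C := M) (ae_of_all _ fun S => hgM _)
    have hGd : ∀ z z', G z - G z' ≤ b := fun z z' => by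
      rw [hG, ← integral_sub (hgi z) (hgi z')]
      calc _ ≤ ∫ _, b ∂(Measure.pi fun _ : Fin n => D) := by
            refine integral_mono ((hgi z).sub (hgi z')) (integrable_const _) fun S => ?_
            have := hgb (Fin.cons z' S) 0 z
            rwa [Fin.update_cons_zero] at this
        _ = b := by simp
    have hne : Nonempty Z := nonempty_of_isProbabilityMeasure D
    have hbdd : BddBelow (Set.range G) :=
      ⟨-M, by rintro _ ⟨z, rfl⟩; exact (abs_le.1 (hGM z)).1⟩
    -- The difference bound over all pairs confines `G` to an interval of length `b`, so Hoeffding's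
    -- lemma applies with variance proxy `(b / 2) ^ 2`.
    have hIcc : ∀ z, G z ∈ Set.Icc (⨅ z, G z) ((⨅ z, G z) + b) := fun z => by
      refine ⟨ciInf_le hbdd z, ?_⟩
      have : G z - b ≤ ⨅ z, G z := le_ciInf fun z' => by linarith [hGd z z']
      linarith
    have hsub := (ProbabilityTheory.hasSubgaussianMGF_of_mem_Icc (μ := D) hGm.aemeasurable
      (ae_of_all _ hIcc)).mgf_le t
    have hmain : ∫ z, Real.exp (t * G z) ∂D ≤
        Real.exp (t * ∫ z, G z ∂D + (b / 2) ^ 2 * t ^ 2 / 2) := by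
      have h1 : ∫ z, Real.exp (t * G z) ∂D =
          Real.exp (t * ∫ z, G z ∂D) * ∫ z, Real.exp (t * (G z - ∫ z, G z ∂D)) ∂D := by
        rw [← integral_const_mul]
        congr 1 with z
        rw [← Real.exp_add]
        ring_nf
      rw [h1, Real.exp_add]
      gcongr
      simpa [ProbabilityTheory.mgf, abs_of_nonneg hb] using hsub
    have hgint : Integrable g (Measure.pi fun _ : Fin (n + 1) => D) :=
      Integrable.of_bound hg.aestronglyMeasurable M (ae_of_all _ hgM)
    rw [integral_pi_succ D (hexp _ g hg hgM), integral_pi_succ D hgint]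
    -- With the first coordinate frozen, the remaining function of `n` points still has differences
    -- at most `b`.
    have hstep : ∀ z, ∫ S, Real.exp (t * g (Fin.cons z S)) ∂(Measure.pi fun _ : Fin n => D) ≤
        Real.exp (t * G z) * Real.exp (n * ((b / 2) ^ 2 * t ^ 2 / 2)) := fun z => by
      rw [← Real.exp_add]
      refine ih _ (hgz z) (fun S => hgM _) fun S i z' => ?_
      have := hgb (Fin.cons z S) i.succ z'
      rwa [← Fin.cons_update] at this
    calc _ ≤ ∫ z, Real.exp (t * G z) * Real.exp (n * ((b / 2) ^ 2 * t ^ 2 / 2)) ∂D := by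
          refine integral_mono_of_nonneg (ae_of_all _ fun z => integral_nonneg fun S =>
            (Real.exp_pos _).le) ((hexp D G hGm hGM).mul_const _) (ae_of_all _ hstep)
      _ = (∫ z, Real.exp (t * G z) ∂D) * Real.exp (n * ((b / 2) ^ 2 * t ^ 2 / 2)) :=
          integral_mul_const _ _
      _ ≤ Real.exp (t * ∫ z, G z ∂D + (b / 2) ^ 2 * t ^ 2 / 2) *
          Real.exp (n * ((b / 2) ^ 2 * t ^ 2 / 2)) := by gcongr
      _ = _ := by
          rw [← Real.exp_add]
          push_cast
          simp only [hG]
          ring_nf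

/-- **McDiarmid's bounded differences inequality** for i.i.d. samples. -/
theorem measureReal_ge_le_of_bounded_differences (D : Measure Z) [IsProbabilityMeasure D]
    {n : ℕ} {b M : ℝ} (hb : 0 ≤ b) {g : (Fin n → Z) → ℝ} (hg : Measurable g)
    (hgM : ∀ S, |g S| ≤ M) (hgb : ∀ S i z, g (Function.update S i z) - g S ≤ b)
    {ε : ℝ} (hε : 0 ≤ ε) :
    (Measure.pi fun _ : Fin n => D).real
        {S | ε ≤ g S - ∫ S, g S ∂(Measure.pi fun _ : Fin n => D)} ≤
      Real.exp (-ε ^ 2 / (2 * (n * (b / 2) ^ 2))) := by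
  set μ := Measure.pi fun _ : Fin n => D
  have hsub : ProbabilityTheory.HasSubgaussianMGF (fun S => g S - ∫ S, g S ∂μ)
      (n * (b.toNNReal / 2) ^ 2) μ := by
    refine ⟨fun t => ?_, fun t => ?_⟩
    · refine Integrable.of_bound (by fun_prop) (Real.exp (|t| * (M + |∫ S, g S ∂μ|)))
        (ae_of_all _ fun x => ?_)
      rw [Real.norm_eq_abs, Real.abs_exp, Real.exp_le_exp]
      calc t * (g x - ∫ S, g S ∂μ) ≤ |t * (g x - ∫ S, g S ∂μ)| := le_abs_self _
        _ = |t| * |g x - ∫ S, g S ∂μ| := abs_mul _ _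
        _ ≤ |t| * (M + |∫ S, g S ∂μ|) := by
          gcongr
          exact (abs_sub _ _).trans (by gcongr; exact hgM x)
    · have h := integral_exp_le_of_bounded_differences D hb t n g hg hgM hgb
      have h1 : ProbabilityTheory.mgf (fun S => g S - ∫ S, g S ∂μ) μ t =
          Real.exp (-(t * ∫ S, g S ∂μ)) * ∫ S, Real.exp (t * g S) ∂μ := by
        rw [ProbabilityTheory.mgf, ← integral_const_mul]
        congr 1 with z
        rw [← Real.exp_add]
        ring_nf
      rw [h1]
      calc _ ≤ _ := mul_le_mul_of_nonneg_left h (Real.exp_pos _).le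
        _ = _ := by
          rw [← Real.exp_add]
          congr 1
          push_cast
          rw [Real.coe_toNNReal _ hb]
          ring
  have := hsub.measure_ge_le hε
  simpa [Real.coe_toNNReal _ hb] using this

end Concentration

/-! ### Expected supremum: symmetrization and contraction -/

section Expectation

variable {ι : Type*} [Finite ι]

lemma le_iSup_of_finite (f : ι → ℝ) (k : ι) : f k ≤ ⨆ k, f k :=
  le_ciSup (Set.finite_range f).bddAbove k

variable [Nonempty ι]

lemma integrable_iSup_of_finite {Ω : Type*} [MeasurableSpace Ω] {μ : Measure Ω} {f : ι → Ω → ℝ}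
    (hf : ∀ k, Integrable (f k) μ) : Integrable (fun ω => ⨆ k, f k ω) μ := by
  have := Fintype.ofFinite ι
  refine Integrable.mono' (g := fun ω => ∑ k, |f k ω|)
    (integrable_finsetSum _ fun k _ => (hf k).abs)
    (AEMeasurable.iSup fun k => (hf k).aemeasurable).aestronglyMeasurable
    (ae_of_all _ fun ω => ?_)
  have h : ∀ k, |f k ω| ≤ ∑ k, |f k ω| := fun k =>
    Finset.single_le_sum (f := fun k => |f k ω|) (fun _ _ => abs_nonneg _) (Finset.mem_univ k)
  rw [Real.norm_eq_abs, abs_le]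
  constructor
  · obtain ⟨k⟩ := ‹Nonempty ι›
    exact (neg_le_of_abs_le (h k)).trans (le_iSup_of_finite (fun k => f k ω) k)
  · exact ciSup_le fun k => (le_abs_self _).trans (h k)

/-- One step of symmetrization. -/
lemma integral_iSup_sub_le {Z : Type*} [MeasurableSpace Z] (D : Measure Z)
    [IsProbabilityMeasure D] (a : ι → ℝ) {h : ι → Z → ℝ} (hh : ∀ k, Integrable (h k) D) :
    ∫ z, (⨆ k, (a k + ((∫ z, h k z ∂D) - h k z))) ∂D ≤
      ∫ z, ((⨆ k, (a k + 2 * h k z)) + ⨆ k, (a k - 2 * h k z)) / 2 ∂D := by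
  have hp : Integrable (fun z => ⨆ k, (a k + 2 * h k z)) D :=
    integrable_iSup_of_finite fun k => (integrable_const _).add ((hh k).const_mul 2)
  have hq : Integrable (fun z => ⨆ k, (a k - 2 * h k z)) D :=
    integrable_iSup_of_finite fun k => (integrable_const _).sub ((hh k).const_mul 2)
  have hl : Integrable (fun z => ⨆ k, (a k + ((∫ z, h k z ∂D) - h k z))) D :=
    integrable_iSup_of_finite fun k =>
      (integrable_const _).add ((integrable_const _).sub (hh k))
  -- Each term is the half-sum of `a k + 2 * ∫ h k` and `a k - 2 * h k z`. Splitting the supremum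
  -- and moving the integral outside it replaces the ghost sample.
  calc _ ≤ ∫ z, ((∫ z, (⨆ k, (a k + 2 * h k z)) ∂D) + ⨆ k, (a k - 2 * h k z)) / 2 ∂D := by
        refine integral_mono hl (((integrable_const _).add hq).div_const 2) fun z => ?_
        refine ciSup_le fun k => ?_
        have h1 : a k + 2 * ∫ z, h k z ∂D ≤ ∫ z, (⨆ k, (a k + 2 * h k z)) ∂D := by
          calc _ = ∫ z, (a k + 2 * h k z) ∂D := by
                rw [integral_add (integrable_const _) ((hh k).const_mul 2), integral_const_mul]
                simp
            _ ≤ _ := integral_mono ((integrable_const _).add ((hh k).const_mul 2)) hp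
                fun z => le_iSup_of_finite (fun k => a k + 2 * h k z) k
        have h2 := le_iSup_of_finite (fun k => a k - 2 * h k z) k
        simp only at h2 ⊢
        linarith
    _ = _ := by
        rw [integral_div, integral_div, integral_add (integrable_const _) hq, integral_add hp hq]
        simp

/-- One step of contraction. -/
lemma iSup_add_iSup_le_of_contraction {τ : Type*} [Fintype τ] (a η : ι → ℝ) (wt : τ → ℝ)
    (hwt : ∀ s, 0 ≤ wt s) (hwt1 : ∑ s, wt s = 1) (u : τ → ι → ℝ)
    (hη : ∀ k l, η k - η l ≤ ∑ s, wt s * |u s k - u s l|) :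
    (⨆ k, (a k + 2 * η k)) + (⨆ k, (a k - 2 * η k)) ≤
      ∑ s, wt s * ((⨆ k, (a k + 2 * u s k)) + ⨆ k, (a k - 2 * u s k)) := by
  refine ciSup_add_ciSup_le fun k l => ?_
  -- Since `a k + a l` is symmetric, the absolute value is removed by choosing which of `k`, `l`
  -- enters which supremum.
  have h : ∀ s, a k + a l + 2 * |u s k - u s l| ≤
      (⨆ k, (a k + 2 * u s k)) + ⨆ k, (a k - 2 * u s k) := fun s => by
    have h1 : ∀ k, a k + 2 * u s k ≤ ⨆ k, (a k + 2 * u s k) := le_iSup_of_finite _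
    have h2 : ∀ k, a k - 2 * u s k ≤ ⨆ k, (a k - 2 * u s k) := le_iSup_of_finite _
    rcases abs_cases (u s k - u s l) with ⟨he, _⟩ | ⟨he, _⟩ <;> rw [he] <;>
      linarith [h1 k, h1 l, h2 k, h2 l]
  calc a k + 2 * η k + (a l - 2 * η l) ≤ a k + a l + 2 * ∑ s, wt s * |u s k - u s l| := by
        linarith [hη k l]
    _ = ∑ s, wt s * (a k + a l + 2 * |u s k - u s l|) := by
        simp only [mul_add, Finset.sum_add_distrib, ← Finset.sum_mul, hwt1, Finset.mul_sum]
        congr 1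
        · ring
        · exact Finset.sum_congr rfl fun s _ => by ring
    _ ≤ _ := Finset.sum_le_sum fun s _ => mul_le_mul_of_nonneg_left (h s) (hwt s)

variable {E : Type*} [NormedAddCommGroup E] [InnerProductSpace ℝ E]

/-- Parallelogram law plus concavity of the square root. This is the inductive step: absorbing one
sample point with both signs adds `4 * R ^ 2` under the root. -/
lemma sqrt_norm_add_sq_add_sqrt_norm_sub_sq_le (V u : E) {C R : ℝ} (hC : 0 ≤ C)
    (hu : ‖u‖ ≤ R) :
    √(‖V + (2 : ℝ) • u‖ ^ 2 + C) + √(‖V - (2 : ℝ) • u‖ ^ 2 + C) ≤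
      2 * √(‖V‖ ^ 2 + (C + 4 * R ^ 2)) := by
  have hpar : ‖V + (2 : ℝ) • u‖ ^ 2 + ‖V - (2 : ℝ) • u‖ ^ 2 = 2 * (‖V‖ ^ 2 + 4 * ‖u‖ ^ 2) := by
    rw [norm_add_sq_real, norm_sub_sq_real, norm_smul, Real.norm_ofNat]
    ring
  have hR : ‖u‖ ^ 2 ≤ R ^ 2 := pow_le_pow_left₀ (norm_nonneg _) hu 2
  refine abs_le_of_sq_le_sq' ?_ (by positivity) |>.2
  have h1 := Real.sq_sqrt (show 0 ≤ ‖V + (2 : ℝ) • u‖ ^ 2 + C by positivity)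
  have h2 := Real.sq_sqrt (show 0 ≤ ‖V - (2 : ℝ) • u‖ ^ 2 + C by positivity)
  have h3 := Real.sq_sqrt (show 0 ≤ ‖V‖ ^ 2 + (C + 4 * R ^ 2) by positivity)
  nlinarith [sq_nonneg (√(‖V + (2 : ℝ) • u‖ ^ 2 + C) - √(‖V - (2 : ℝ) • u‖ ^ 2 + C))]

/-- The expected uniform deviation over a finite family of functions `h k` indexed by vectors `w k`
of norm at most `Λ`, where at each point the increments of `h` are dominated by an average of
increments of linear functionals of norm at most `R`. -/
theorem integral_iSup_inner_add_deviation_le {Z : Type*} [MeasurableSpace Z] (D : Measure Z)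
    [IsProbabilityMeasure D] {τ : Type*} [Fintype τ] {Λ R : ℝ} {w : ι → E} (hw : ∀ k, ‖w k‖ ≤ Λ)
    {h : ι → Z → ℝ} (hh : ∀ k, Integrable (h k) D)
    (hc : ∀ z, ∃ (wt : τ → ℝ) (u : τ → E), (∀ s, 0 ≤ wt s) ∧ ∑ s, wt s = 1 ∧ (∀ s, ‖u s‖ ≤ R) ∧
      ∀ k l, h k z - h l z ≤ ∑ s, wt s * |inner ℝ (w k) (u s) - inner ℝ (w l) (u s)|)
    (n : ℕ) (V : E) :
    ∫ S, (⨆ k, (inner ℝ (w k) V + ∑ i, ((∫ z, h k z ∂D) - h k (S i))))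
        ∂(Measure.pi fun _ : Fin n => D) ≤ Λ * √(‖V‖ ^ 2 + n * (4 * R ^ 2)) := by
  have hΛ : 0 ≤ Λ := by
    obtain ⟨k⟩ := ‹Nonempty ι›
    exact (norm_nonneg _).trans (hw k)
  have hsum : ∀ (m : ℕ) k, Integrable (fun S : Fin m → Z => ∑ i, ((∫ z, h k z ∂D) - h k (S i)))
      (Measure.pi fun _ : Fin m => D) := fun m k =>
    integrable_finsetSum _ fun i _ => (integrable_const _).sub (integrable_comp_eval (hh k))
  have hint : ∀ (m : ℕ) (b : ι → ℝ), Integrable (fun S : Fin m → Z =>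
      ⨆ k, (b k + ∑ i, ((∫ z, h k z ∂D) - h k (S i)))) (Measure.pi fun _ : Fin m => D) :=
    fun m b => integrable_iSup_of_finite fun k => (integrable_const _).add (hsum m k)
  -- `V` must vary: it stores the signed functionals of the points already removed. With none left,
  -- Cauchy–Schwarz finishes.
  induction n generalizing V with
  | zero =>
    simp only [Finset.univ_eq_empty, Finset.sum_empty, add_zero, integral_const,
      probReal_univ, one_smul, Nat.cast_zero, zero_mul, Real.sqrt_sq (norm_nonneg V)]
    exact ciSup_le fun k => (real_inner_le_norm _ _).trans (by gcongr; exact hw k)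
  | succ n ih =>
    set μ := Measure.pi fun _ : Fin n => D with hμ
    set a : (Fin n → Z) → ι → ℝ := fun S k =>
      inner ℝ (w k) V + ∑ i, ((∫ z, h k z ∂D) - h k (S i)) with ha
    have hai : ∀ k, Integrable (fun S => a S k) μ := fun k =>
      (integrable_const _).add (hsum n k)
    rw [integral_pi_succ D (hint (n + 1) _)]
    have hcons : ∀ z (S : Fin n → Z) k, inner ℝ (w k) V + ∑ i : Fin (n + 1), ((∫ z, h k z ∂D) -
        h k ((Fin.cons z S : Fin (n + 1) → Z) i)) =
        a S k + ((∫ z, h k z ∂D) - h k z) := fun z S k => by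
      rw [Fin.sum_univ_succ]
      simp only [Fin.cons_zero, Fin.cons_succ, ha]
      ring
    simp only [hcons]
    have hha : ∀ k, Integrable (fun p : Z × (Fin n → Z) => a p.2 k) (D.prod μ) :=
      fun k => (hai k).comp_snd D
    have hhh : ∀ k, Integrable (fun p : Z × (Fin n → Z) => h k p.1) (D.prod μ) :=
      fun k => (hh k).comp_fst μ
    have hI1 : Integrable (fun p : Z × (Fin n → Z) =>
        ⨆ k, (a p.2 k + ((∫ z, h k z ∂D) - h k p.1))) (D.prod μ) :=
      integrable_iSup_of_finite fun k => (hha k).add ((integrable_const _).sub (hhh k))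
    have hI2 : Integrable (fun p : Z × (Fin n → Z) =>
        ((⨆ k, (a p.2 k + 2 * h k p.1)) + ⨆ k, (a p.2 k - 2 * h k p.1)) / 2) (D.prod μ) :=
      ((integrable_iSup_of_finite fun k => (hha k).add ((hhh k).const_mul 2)).add
        (integrable_iSup_of_finite fun k => (hha k).sub ((hhh k).const_mul 2))).div_const 2
    have hz : ∀ z, ∫ S, ((⨆ k, (a S k + 2 * h k z)) + ⨆ k, (a S k - 2 * h k z)) / 2 ∂μ ≤
        Λ * √(‖V‖ ^ 2 + (n + 1 : ℕ) * (4 * R ^ 2)) := fun z => by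
      obtain ⟨wt, u, hwt, hwt1, huR, hinc⟩ := hc z
      have hpint : ∀ s, Integrable (fun S => ⨆ k, (a S k + 2 * inner ℝ (w k) (u s))) μ :=
        fun s => integrable_iSup_of_finite fun k => (hai k).add (integrable_const _)
      have hqint : ∀ s, Integrable (fun S => ⨆ k, (a S k - 2 * inner ℝ (w k) (u s))) μ :=
        fun s => integrable_iSup_of_finite fun k => (hai k).sub (integrable_const _)
      have hsint : ∀ s, Integrable (fun S => wt s * ((⨆ k, (a S k + 2 * inner ℝ (w k) (u s))) +
          ⨆ k, (a S k - 2 * inner ℝ (w k) (u s)))) μ :=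
        fun s => ((hpint s).add (hqint s)).const_mul _
      -- The extra linear term is a shift of `V`, so the induction hypothesis covers it.
      have hpV : ∀ s, ∫ S, (⨆ k, (a S k + 2 * inner ℝ (w k) (u s))) ∂μ ≤
          Λ * √(‖V + (2 : ℝ) • u s‖ ^ 2 + n * (4 * R ^ 2)) := fun s => by
        refine le_trans (le_of_eq ?_) (ih (V + (2 : ℝ) • u s))
        congr 1 with S
        congr 1 with k
        rw [ha, inner_add_right, real_inner_smul_right]
        ring
      have hqV : ∀ s, ∫ S, (⨆ k, (a S k - 2 * inner ℝ (w k) (u s))) ∂μ ≤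
          Λ * √(‖V - (2 : ℝ) • u s‖ ^ 2 + n * (4 * R ^ 2)) := fun s => by
        refine le_trans (le_of_eq ?_) (ih (V - (2 : ℝ) • u s))
        congr 1 with S
        congr 1 with k
        rw [ha, inner_sub_right, real_inner_smul_right]
        ring
      calc _ ≤ ∫ S, (∑ s, wt s * ((⨆ k, (a S k + 2 * inner ℝ (w k) (u s))) +
            ⨆ k, (a S k - 2 * inner ℝ (w k) (u s)))) / 2 ∂μ := by
            refine integral_mono ?_ ?_ fun S => ?_
            · exact ((integrable_iSup_of_finite fun k => (hai k).add (integrable_const _)).add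
                (integrable_iSup_of_finite fun k => (hai k).sub (integrable_const _))).div_const 2
            · exact (integrable_finsetSum _ fun s _ => hsint s).div_const 2
            · exact div_le_div_of_nonneg_right (iSup_add_iSup_le_of_contraction (a S)
                (fun k => h k z) wt hwt hwt1 (fun s k => inner ℝ (w k) (u s)) hinc) zero_le_two
        _ = (∑ s, wt s * ((∫ S, (⨆ k, (a S k + 2 * inner ℝ (w k) (u s))) ∂μ) +
            ∫ S, (⨆ k, (a S k - 2 * inner ℝ (w k) (u s))) ∂μ)) / 2 := by
            rw [integral_div, integral_finsetSum _ fun s _ => hsint s]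
            congr 1
            refine Finset.sum_congr rfl fun s _ => ?_
            rw [integral_const_mul, integral_add (hpint s) (hqint s)]
        _ ≤ (∑ s, wt s * (2 * (Λ * √(‖V‖ ^ 2 + (n + 1 : ℕ) * (4 * R ^ 2))))) / 2 := by
            gcongr with s
            · exact hwt s
            have h1 := sqrt_norm_add_sq_add_sqrt_norm_sub_sq_le V (u s)
              (C := n * (4 * R ^ 2)) (by positivity) (huR s)
            have h2 : (n * (4 * R ^ 2) + 4 * R ^ 2 : ℝ) = (n + 1 : ℕ) * (4 * R ^ 2) := by
              push_cast; ring
            rw [h2] at h1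
            nlinarith [hpV s, hqV s, mul_le_mul_of_nonneg_left h1 hΛ]
        _ = _ := by
            rw [← Finset.sum_mul, hwt1]
            ring
    -- Symmetrization integrates over the removed point with `S` fixed; contraction needs that point
    -- fixed. Hence the two exchanges of integrals.
    calc _ = ∫ S, ∫ z, (⨆ k, (a S k + ((∫ z, h k z ∂D) - h k z))) ∂D ∂μ :=
          integral_integral_swap hI1
      _ ≤ ∫ S, ∫ z, ((⨆ k, (a S k + 2 * h k z)) + ⨆ k, (a S k - 2 * h k z)) / 2 ∂D ∂μ :=
          integral_mono hI1.integral_prod_right hI2.integral_prod_right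
            fun S => integral_iSup_sub_le D (a S) hh
      _ = ∫ z, ∫ S, ((⨆ k, (a S k + 2 * h k z)) + ⨆ k, (a S k - 2 * h k z)) / 2 ∂μ ∂D :=
          (integral_integral_swap hI2).symm
      _ ≤ ∫ _, Λ * √(‖V‖ ^ 2 + (n + 1 : ℕ) * (4 * R ^ 2)) ∂D :=
          integral_mono hI2.integral_prod_left (integrable_const _) hz
      _ = _ := by simp

end Expectation

/-! ### Hamming and ranking losses -/

section Losses

variable {c : ℕ}

/-- The average of `F p q` over the pairs of a relevant label `p` and an irrelevant label `q`. -/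
noncomputable def pairAverage (y : Labels c) (F : Fin c → Fin c → ℝ) : ℝ :=
  (1 / (((relevant y).card : ℝ) * ((irrelevant y).card : ℝ))) *
    ∑ p ∈ relevant y, ∑ q ∈ irrelevant y, F p q

lemma rankingLoss_eq_pairAverage (v : Fin c → ℝ) (y : Labels c) :
    rankingLoss v y = pairAverage y fun p q => if v p ≤ v q then (1 : ℝ) else 0 := rfl

lemma surrogateRankingLoss_eq_pairAverage (ℓ : ℝ → ℝ) (v : Fin c → ℝ) (y : Labels c) :
    surrogateRankingLoss ℓ v y = pairAverage y fun p q => ℓ (v p - v q) := rfl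

lemma pairAverage_mono (y : Labels c) {F G : Fin c → Fin c → ℝ} (h : ∀ p q, F p q ≤ G p q) :
    pairAverage y F ≤ pairAverage y G := by
  unfold pairAverage
  gcongr
  exact h _ _

lemma pairAverage_nonneg (y : Labels c) {F : Fin c → Fin c → ℝ} (h : ∀ p q, 0 ≤ F p q) :
    0 ≤ pairAverage y F :=
  mul_nonneg (by positivity) (Finset.sum_nonneg fun p _ => Finset.sum_nonneg fun q _ => h p q)

/-- The total weight is `1`, or `0` if a class is empty; the latter case requires `0 ≤ B`. -/
lemma pairAverage_le (y : Labels c) {F : Fin c → Fin c → ℝ} {B : ℝ} (hB : 0 ≤ B)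
    (h : ∀ p q, F p q ≤ B) : pairAverage y F ≤ B := by
  refine (pairAverage_mono y h).trans ?_
  unfold pairAverage
  simp only [Finset.sum_const, nsmul_eq_mul]
  rw [← mul_assoc _ _ B, ← mul_assoc]
  refine mul_le_of_le_one_left hB ?_
  rw [one_div]
  exact inv_mul_le_one

/-- If both label classes are nonempty, `pairAverage` is a convex combination over all pairs. -/
lemma pairAverage_eq_sum (y : Labels c) :
    ∃ wt : Fin c × Fin c → ℝ, (∀ s, 0 ≤ wt s) ∧
      (0 < (relevant y).card * (irrelevant y).card → ∑ s, wt s = 1) ∧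
      ∀ F, pairAverage y F = ∑ s, wt s * F s.1 s.2 := by
  classical
  refine ⟨fun s => if s ∈ relevant y ×ˢ irrelevant y then
    1 / (((relevant y).card : ℝ) * ((irrelevant y).card : ℝ)) else 0, fun s => ?_, fun h => ?_,
    fun F => ?_⟩
  · dsimp only
    split_ifs <;> positivity
  · have h' : ((relevant y).card : ℝ) * ((irrelevant y).card : ℝ) ≠ 0 := by exact_mod_cast h.ne'
    rw [Finset.sum_ite_mem, Finset.univ_inter, Finset.sum_const, Finset.card_product, nsmul_eq_mul]
    rw [Nat.cast_mul, mul_one_div, div_self h']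
  · simp only [ite_mul, zero_mul, Finset.sum_ite_mem, Finset.univ_inter, pairAverage]
    rw [Finset.sum_product, Finset.mul_sum]
    simp only [Finset.mul_sum]

lemma rankingLoss_nonneg (v : Fin c → ℝ) (y : Labels c) : 0 ≤ rankingLoss v y :=
  pairAverage_nonneg y fun p q => by split_ifs <;> norm_num

lemma rankingLoss_le_one (v : Fin c → ℝ) (y : Labels c) : rankingLoss v y ≤ 1 :=
  pairAverage_le y zero_le_one fun p q => by split_ifs <;> norm_num

lemma rankingLoss_le_surrogateRankingLoss {ℓ : ℝ → ℝ}
    (hℓ : ∀ u, (if u ≤ 0 then (1 : ℝ) else 0) ≤ ℓ u) (v : Fin c → ℝ) (y : Labels c) :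
    rankingLoss v y ≤ surrogateRankingLoss ℓ v y :=
  pairAverage_mono y fun p q => by simpa only [sub_nonpos] using hℓ (v p - v q)

lemma hammingLoss_nonneg (s y : Labels c) : 0 ≤ hammingLoss s y :=
  mul_nonneg (by positivity) (Finset.sum_nonneg fun j _ => by split_ifs <;> norm_num)

lemma hammingLoss_le_one (s y : Labels c) : hammingLoss s y ≤ 1 := by
  unfold hammingLoss
  have h : ∑ j, (if s j ≠ y j then (1 : ℝ) else 0) ≤ ∑ _j : Fin c, 1 :=
    Finset.sum_le_sum fun j _ => by split_ifs <;> norm_num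
  calc _ ≤ 1 / (c : ℝ) * ∑ _j : Fin c, (1 : ℝ) := by gcongr
    _ ≤ 1 := by
      simp only [Finset.sum_const, Finset.card_univ, Fintype.card_fin, nsmul_eq_mul, mul_one,
        one_div]
      exact inv_mul_le_one

lemma exists_hammingLoss_threshold_le (v : Fin c → ℝ) (y : Labels c) :
    ∃ T, hammingLoss (threshold T v) y ≤ c * rankingLoss v y := by
  have hc0 : 0 ≤ c * rankingLoss v y := mul_nonneg (Nat.cast_nonneg c) (rankingLoss_nonneg v y)
  rcases (irrelevant y).eq_empty_or_nonempty with hN | hN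
  -- This threshold lies below every score, so all labels are predicted relevant, which is correct
  -- here.
  · refine ⟨-∑ j, |v j|, le_of_eq_of_le ?_ hc0⟩
    have h : ∀ j, threshold (-∑ j, |v j|) v j = y j := fun j => by
      have hj : y j = 1 := by
        have : j ∉ irrelevant y := by simp [hN]
        simp only [irrelevant, Finset.mem_filter, Finset.mem_univ, true_and] at this
        exact (Int.units_eq_one_or (y j)).resolve_right this
      have h1 : |v j| ≤ ∑ j, |v j| :=
        Finset.single_le_sum (f := fun j => |v j|) (fun _ _ => abs_nonneg _) (Finset.mem_univ j)
      rw [threshold, if_pos (neg_le_of_abs_le h1), hj]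
    simp [hammingLoss, h]
  · obtain ⟨q, hq, hmax⟩ := (irrelevant y).exists_max_image v hN
    -- With finitely many scores, some `T` lies strictly above `v q` and below every larger score.
    obtain ⟨T, hT⟩ : ∃ T, ∀ j, T ≤ v j ↔ v q < v j := by
      have h : ∀ᶠ T in nhdsWithin (v q) (Set.Ioi (v q)), ∀ j, T ≤ v j ↔ v q < v j := by
        rw [Filter.eventually_all]
        intro j
        rcases lt_or_ge (v q) (v j) with hj | hj
        · filter_upwards [Ioo_mem_nhdsGT hj] with T hT using ⟨fun _ => hj, fun _ => hT.2.le⟩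
        · filter_upwards [self_mem_nhdsWithin] with T hT
          exact ⟨fun h => absurd (h.trans hj) (not_le.2 hT), fun h => absurd h (not_lt.2 hj)⟩
      exact h.exists
    refine ⟨T, ?_⟩
    have hle : ∑ j, (if threshold T v j ≠ y j then (1 : ℝ) else 0) ≤
        ∑ p ∈ relevant y, ∑ q ∈ irrelevant y, if v p ≤ v q then (1 : ℝ) else 0 := by
      rw [relevant, Finset.sum_filter]
      refine Finset.sum_le_sum fun j _ => ?_
      rcases Int.units_eq_one_or (y j) with hj | hj
      · rw [if_pos hj, hj]
        have hq1 : (if v j ≤ v q then (1 : ℝ) else 0) ≤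
            ∑ q ∈ irrelevant y, if v j ≤ v q then (1 : ℝ) else 0 :=
          Finset.single_le_sum (f := fun q => if v j ≤ v q then (1 : ℝ) else 0)
            (fun _ _ => by split_ifs <;> norm_num) hq
        refine le_trans ?_ hq1
        by_cases h : v j ≤ v q
        · rw [if_pos h]
          split_ifs <;> norm_num
        · rw [threshold, if_pos ((hT j).2 (not_le.1 h))]
          simp [h]
      · have hjN : j ∈ irrelevant y := by simp [irrelevant, hj]
        have : ¬ T ≤ v j := fun h => absurd ((hT j).1 h) (not_lt.2 (hmax j hjN))
        rw [threshold, if_neg this, hj]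
        simp
    rcases (relevant y).eq_empty_or_nonempty with hP | hP
    · rw [hP, Finset.sum_empty] at hle
      exact (mul_nonpos_of_nonneg_of_nonpos (by positivity) hle).trans hc0
    · have ha : (0 : ℝ) < (relevant y).card := by exact_mod_cast hP.card_pos
      have hb : (0 : ℝ) < (irrelevant y).card := by exact_mod_cast hN.card_pos
      have hac : ((relevant y).card : ℝ) ≤ c := by
        exact_mod_cast (Finset.card_le_univ _).trans (Fintype.card_fin c).le
      have hbc : ((irrelevant y).card : ℝ) ≤ c := by
        exact_mod_cast (Finset.card_le_univ _).trans (Fintype.card_fin c).le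
      have hc : (0 : ℝ) < c := ha.trans_le hac
      unfold hammingLoss rankingLoss
      rw [← mul_assoc]
      refine mul_le_mul ?_ hle (Finset.sum_nonneg fun j _ => by split_ifs <;> norm_num)
        (by positivity)
      rw [mul_one_div, div_le_div_iff₀ hc (by positivity), one_mul]
      exact mul_le_mul hac hbc hb.le hc.le

lemma IsOracleThreshold.hammingLoss_le {t : (Fin c → ℝ) → Labels c → Labels c}
    (ht : IsOracleThreshold t) (v : Fin c → ℝ) (y : Labels c) :
    hammingLoss (t v y) y ≤ c * rankingLoss v y := by
  obtain ⟨T, hT⟩ := exists_hammingLoss_threshold_le v y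
  exact ((ht v y).2 T).trans hT

/-- Lowering `T` slightly changes no prediction. The oracle loss is therefore a countable infimum,
hence measurable although `t` itself need not be. -/
lemma exists_rat_threshold_eq (T : ℝ) (v : Fin c → ℝ) :
    ∃ q : ℚ, threshold (q : ℝ) v = threshold T v := by
  have h : ∀ᶠ T' in nhdsWithin T (Set.Iio T), ∀ j, T' ≤ v j ↔ T ≤ v j := by
    rw [Filter.eventually_all]
    intro j
    rcases lt_or_ge (v j) T with hj | hj
    · filter_upwards [Ioo_mem_nhdsLT hj] with T' hT'
      exact ⟨fun h => absurd h (not_le.2 hT'.1), fun h => absurd h (not_le.2 hj)⟩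
    · filter_upwards [self_mem_nhdsWithin] with T' hT'
      exact ⟨fun _ => hj, fun _ => (le_of_lt hT').trans hj⟩
  obtain ⟨a, ha, hsub⟩ := (mem_nhdsLT_iff_exists_Ioo_subset).1 h
  obtain ⟨q, hq1, hq2⟩ := exists_rat_btwn (Set.mem_Iio.1 ha)
  refine ⟨q, funext fun j => ?_⟩
  simp only [threshold, hsub ⟨hq1, hq2⟩ j]

lemma IsOracleThreshold.hammingLoss_eq_iInf {t : (Fin c → ℝ) → Labels c → Labels c}
    (ht : IsOracleThreshold t) (v : Fin c → ℝ) (y : Labels c) :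
    hammingLoss (t v y) y = ⨅ q : ℚ, hammingLoss (threshold (q : ℝ) v) y := by
  refine le_antisymm (le_ciInf fun q => (ht v y).2 q) ?_
  obtain ⟨T, hT⟩ := (ht v y).1
  obtain ⟨q, hq⟩ := exists_rat_threshold_eq T v
  rw [hT, ← hq]
  exact ciInf_le ⟨0, by rintro _ ⟨q, rfl⟩; exact hammingLoss_nonneg _ _⟩ q

lemma measurable_threshold (T : ℝ) : Measurable (threshold (c := c) T) :=
  measurable_pi_lambda _ fun j =>
    Measurable.ite (measurableSet_le measurable_const (measurable_pi_apply j))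
      measurable_const measurable_const

lemma IsOracleThreshold.measurable_hammingLoss {t : (Fin c → ℝ) → Labels c → Labels c}
    (ht : IsOracleThreshold t) (y : Labels c) : Measurable fun v => hammingLoss (t v y) y := by
  simp only [ht.hammingLoss_eq_iInf]
  exact Measurable.iInf fun q =>
    (measurable_of_finite fun s : Labels c => hammingLoss s y).comp (measurable_threshold _)

lemma measurable_rankingLoss (y : Labels c) : Measurable fun v => rankingLoss v y := by
  unfold rankingLoss
  refine Measurable.const_mul (Finset.measurable_fun_sum _ fun p _ =>
    Finset.measurable_fun_sum _ fun q _ => ?_) _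
  exact Measurable.ite (measurableSet_le (measurable_pi_apply p) (measurable_pi_apply q))
    measurable_const measurable_const

lemma continuous_surrogateRankingLoss {ℓ : ℝ → ℝ} (hℓ : Continuous ℓ) (y : Labels c) :
    Continuous fun v => surrogateRankingLoss ℓ v y := by
  unfold surrogateRankingLoss
  fun_prop

lemma measurable_loss_comp {X : Type*} [MeasurableSpace X]
    {L : (Fin c → ℝ) → Labels c → ℝ} (hL : ∀ y, Measurable fun v => L v y)
    {f : X → Fin c → ℝ} (hf : Measurable f) :
    Measurable fun z : X × Labels c => L (f z.1) z.2 :=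
  measurable_from_prod_countable_left fun y => (hL y).comp hf

lemma integrable_loss_comp {X : Type*} [MeasurableSpace X] {D : Measure (X × Labels c)}
    [IsProbabilityMeasure D] {L : (Fin c → ℝ) → Labels c → ℝ}
    (hL : ∀ y, Measurable fun v => L v y) {f : X → Fin c → ℝ} (hf : Measurable f) {B : ℝ}
    (h0 : ∀ x y, 0 ≤ L (f x) y) (hB : ∀ x y, L (f x) y ≤ B) :
    Integrable (fun z : X × Labels c => L (f z.1) z.2) D :=
  Integrable.of_bound (measurable_loss_comp hL hf).aestronglyMeasurable B
    (ae_of_all _ fun z => by rw [Real.norm_of_nonneg (h0 _ _)]; exact hB _ _)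

end Losses

/-! ### Uniform deviation over finite and countable families -/

section Deviation

variable {Z : Type*} [MeasurableSpace Z] {E : Type*} [NormedAddCommGroup E] [InnerProductSpace ℝ E]

/-- The deviation of the sample sum of `F` from its expectation. -/
noncomputable def deviation (D : Measure Z) (F : Z → ℝ) {n : ℕ} (S : Fin n → Z) : ℝ :=
  ∑ i, ((∫ z, F z ∂D) - F (S i))

lemma measurable_deviation (D : Measure Z) {F : Z → ℝ} (hF : Measurable F) (n : ℕ) :
    Measurable (deviation D F (n := n)) :=
  Finset.measurable_fun_sum _ fun i _ => (hF.comp (measurable_pi_apply i)).const_sub _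

lemma deviation_update_sub_le (D : Measure Z) {F : Z → ℝ} {B : ℝ} (h0 : ∀ z, 0 ≤ F z)
    (hB : ∀ z, F z ≤ B) {n : ℕ} (S : Fin n → Z) (i : Fin n) (z : Z) :
    deviation D F (Function.update S i z) - deviation D F S ≤ B := by
  unfold deviation
  rw [← Finset.sum_sub_distrib, Finset.sum_eq_single i]
  · rw [Function.update_self]
    linarith [h0 z, hB (S i)]
  · intro j _ hj
    rw [Function.update_of_ne hj, sub_self]
  · simp

lemma abs_deviation_le (D : Measure Z) [IsProbabilityMeasure D] {F : Z → ℝ} {B : ℝ}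
    (h0 : ∀ z, 0 ≤ F z) (hB : ∀ z, F z ≤ B) {n : ℕ} (S : Fin n → Z) :
    |deviation D F S| ≤ n * (2 * B) := by
  have hF : ∀ z, |F z| ≤ B := fun z => by rw [abs_of_nonneg (h0 z)]; exact hB z
  have hI : |∫ z, F z ∂D| ≤ B := by
    simpa using norm_integral_le_of_norm_le_const (μ := D) (f := F) (C := B) (ae_of_all _ hF)
  calc |deviation D F S| ≤ ∑ i, |(∫ z, F z ∂D) - F (S i)| := Finset.abs_sum_le_sum_abs _ _
    _ ≤ ∑ _i : Fin n, 2 * B := Finset.sum_le_sum fun i _ =>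
        (abs_sub _ _).trans (by linarith [hF (S i)])
    _ = _ := by simp

/-- Uniform deviation bound over a finite family. -/
lemma measureReal_exists_lt_deviation_le (D : Measure Z) [IsProbabilityMeasure D]
    {ι : Type*} [Finite ι] [Nonempty ι] {τ : Type*} [Fintype τ] {Λ R B : ℝ} {w : ι → E}
    (hw : ∀ k, ‖w k‖ ≤ Λ) {h : ι → Z → ℝ} (hm : ∀ k, Measurable (h k))
    (h0 : ∀ k z, 0 ≤ h k z) (hB : ∀ k z, h k z ≤ B)
    (hc : ∀ z, ∃ (wt : τ → ℝ) (u : τ → E), (∀ s, 0 ≤ wt s) ∧ ∑ s, wt s = 1 ∧ (∀ s, ‖u s‖ ≤ R) ∧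
      ∀ k l, h k z - h l z ≤ ∑ s, wt s * |inner ℝ (w k) (u s) - inner ℝ (w l) (u s)|)
    (n : ℕ) {ε : ℝ} (hε : 0 ≤ ε) :
    (Measure.pi fun _ : Fin n => D).real
        {S | ∃ k, Λ * √(n * (4 * R ^ 2)) + ε < deviation D (h k) S} ≤
      Real.exp (-ε ^ 2 / (2 * (n * (B / 2) ^ 2))) := by
  obtain ⟨k₀⟩ := ‹Nonempty ι›
  obtain ⟨z₀⟩ := nonempty_of_isProbabilityMeasure D
  have : Nonempty ι := ⟨k₀⟩
  have hB0 : 0 ≤ B := (h0 k₀ z₀).trans (hB k₀ z₀)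
  set g : (Fin n → Z) → ℝ := fun S => ⨆ k, deviation D (h k) S with hg
  have hgm : Measurable g := Measurable.iSup fun k => measurable_deviation D (hm k) n
  have hdev : ∀ k S, |deviation D (h k) S| ≤ n * (2 * B) :=
    fun k S => abs_deviation_le D (h0 k) (hB k) S
  have hgM : ∀ S, |g S| ≤ n * (2 * B) := fun S => abs_le.2
    ⟨(abs_le.1 (hdev k₀ S)).1.trans (le_iSup_of_finite (fun k => deviation D (h k) S) k₀),
      ciSup_le fun k => (abs_le.1 (hdev k S)).2⟩
  have hgb : ∀ S i z, g (Function.update S i z) - g S ≤ B := fun S i z => by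
    rw [sub_le_iff_le_add]
    refine ciSup_le fun k => ?_
    have h1 := deviation_update_sub_le D (h0 k) (hB k) S i z
    have h2 : deviation D (h k) S ≤ g S := le_iSup_of_finite (fun k => deviation D (h k) S) k
    linarith
  have hE : ∫ S, g S ∂(Measure.pi fun _ : Fin n => D) ≤ Λ * √(n * (4 * R ^ 2)) := by
    have hi : ∀ k, Integrable (h k) D := fun k =>
      Integrable.of_bound (hm k).aestronglyMeasurable B
        (ae_of_all _ fun z => by rw [Real.norm_of_nonneg (h0 k z)]; exact hB k z)
    simpa [hg, deviation] using integral_iSup_inner_add_deviation_le D hw hi hc n 0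
  refine (measureReal_mono ?_ (measure_ne_top _ _)).trans
    (measureReal_ge_le_of_bounded_differences D hB0 hgm hgM hgb hε)
  rintro S ⟨k, hk⟩
  have h2 : deviation D (h k) S ≤ g S := le_iSup_of_finite (fun k => deviation D (h k) S) k
  simp only [Set.mem_ofPred_eq]
  linarith

/-- Uniform deviation bound over a countable family. -/
theorem ofReal_one_sub_le_measure_forall_deviation_le (D : Measure Z) [IsProbabilityMeasure D]
    {τ : Type*} [Fintype τ] {Λ R B : ℝ} {w : ℕ → E}
    (hw : ∀ k, ‖w k‖ ≤ Λ) {h : ℕ → Z → ℝ} (hm : ∀ k, Measurable (h k))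
    (h0 : ∀ k z, 0 ≤ h k z) (hB : ∀ k z, h k z ≤ B)
    (hc : ∀ z, ∃ (wt : τ → ℝ) (u : τ → E), (∀ s, 0 ≤ wt s) ∧ ∑ s, wt s = 1 ∧ (∀ s, ‖u s‖ ≤ R) ∧
      ∀ k l, h k z - h l z ≤ ∑ s, wt s * |inner ℝ (w k) (u s) - inner ℝ (w l) (u s)|)
    (n : ℕ) {ε : ℝ} (hε : 0 ≤ ε) :
    ENNReal.ofReal (1 - Real.exp (-ε ^ 2 / (2 * (n * (B / 2) ^ 2)))) ≤
      (Measure.pi fun _ : Fin n => D)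
        {S | ∀ k, deviation D (h k) S ≤ Λ * √(n * (4 * R ^ 2)) + ε} := by
  set μ := Measure.pi fun _ : Fin n => D
  set C := Λ * √(n * (4 * R ^ 2)) + ε
  have hA : MeasurableSet {S : Fin n → Z | ∃ k, C < deviation D (h k) S} := by
    rw [Set.ofPred_exists]
    exact MeasurableSet.iUnion fun k =>
      measurableSet_lt measurable_const (measurable_deviation D (hm k) n)
  have hcompl : {S : Fin n → Z | ∀ k, deviation D (h k) S ≤ C} =
      {S | ∃ k, C < deviation D (h k) S}ᶜ := by
    ext S
    simp
  -- Continuity from below suffices, because the finite-family bound does not depend on the size of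
  -- the family.
  have hunion : {S : Fin n → Z | ∃ k, C < deviation D (h k) S} =
      ⋃ m : ℕ, {S | ∃ k : Fin (m + 1), C < deviation D (h k) S} := by
    ext S
    simp only [Set.mem_ofPred_eq, Set.mem_iUnion]
    exact ⟨fun ⟨k, hk⟩ => ⟨k, ⟨k, k.lt_succ_self⟩, hk⟩, fun ⟨_, k, hk⟩ => ⟨k, hk⟩⟩
  have hmono : Monotone fun m : ℕ => {S : Fin n → Z | ∃ k : Fin (m + 1),
      C < deviation D (h k) S} := by
    rintro m m' hmm S ⟨k, hk⟩
    exact ⟨⟨k, k.2.trans_le (by omega)⟩, hk⟩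
  rw [hcompl, prob_compl_eq_one_sub hA, ENNReal.ofReal_sub _ (Real.exp_pos _).le,
    ENNReal.ofReal_one]
  refine tsub_le_tsub_left ?_ _
  rw [hunion, hmono.measure_iUnion]
  refine iSup_le fun m => ?_
  rw [← ofReal_measureReal]
  refine ENNReal.ofReal_le_ofReal ?_
  refine measureReal_exists_lt_deviation_le D (τ := τ) (w := fun k : Fin (m + 1) => w k)
    (h := fun k : Fin (m + 1) => h k) (fun k => hw k) (fun k => hm k) (fun k => h0 k)
    (fun k => hB k) (fun z => ?_) n hε
  obtain ⟨wt, u, h1, h2, h3, h4⟩ := hc z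
  exact ⟨wt, u, h1, h2, h3, fun k l => h4 k l⟩

end Deviation

/-! ### Linear scores in the product Hilbert space -/

section LinearScores

variable {X H : Type*} [NormedAddCommGroup H] [InnerProductSpace ℝ H] {c : ℕ}

/-- The scores `(⟨w₁, φ x⟩, …, ⟨w_c, φ x⟩)`. -/
noncomputable def linearScore (φ : X → H) (w : PiLp 2 fun _ : Fin c => H) (x : X) (j : Fin c) : ℝ :=
  inner ℝ (w j) (φ x)

lemma linearScore_mem_hypothesisSet {φ : X → H} {Λ : ℝ} {w : PiLp 2 fun _ : Fin c => H}
    (hw : ‖w‖ ≤ Λ) : linearScore φ w ∈ hypothesisSet c φ Λ :=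
  ⟨w, by rwa [← PiLp.norm_eq_of_L2], fun _ _ => rfl⟩

lemma exists_eq_linearScore {φ : X → H} {Λ : ℝ} {f : X → Fin c → ℝ}
    (hf : f ∈ hypothesisSet c φ Λ) :
    ∃ w : PiLp 2 fun _ : Fin c => H, ‖w‖ ≤ Λ ∧ f = linearScore φ w := by
  obtain ⟨W, hW, hfW⟩ := hf
  refine ⟨WithLp.toLp 2 W, by rwa [PiLp.norm_eq_of_L2], ?_⟩
  funext x j
  exact hfW x j

lemma measurable_of_mem_hypothesisSet [MeasurableSpace X] {φ : X → H} (hφ : StronglyMeasurable φ)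
    {Λ : ℝ} {f : X → Fin c → ℝ} (hf : f ∈ hypothesisSet c φ Λ) : Measurable f := by
  obtain ⟨W, -, hfW⟩ := hf
  refine measurable_pi_lambda _ fun j => ?_
  simp only [hfW]
  exact (stronglyMeasurable_const.inner hφ).measurable

lemma continuous_linearScore (φ : X → H) (x : X) :
    Continuous fun w : PiLp 2 fun _ : Fin c => H => linearScore φ w x := by
  unfold linearScore
  fun_prop

lemma inner_single_right (w : PiLp 2 fun _ : Fin c => H) (p : Fin c) (a : H) :
    inner ℝ w (PiLp.single 2 p a) = inner ℝ (w p) a := by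
  rw [PiLp.inner_apply, Finset.sum_eq_single p]
  · simp
  · intro q _ hq
    rw [PiLp.single_eq_of_ne 2 hq, inner_zero_right]
  · simp

/-- For `p ≠ q` the two blocks are orthogonal, which gives `√2` rather than `2`. -/
lemma norm_single_sub_single_le (p q : Fin c) {a : H} {r : ℝ} (ha : ‖a‖ ≤ r) :
    ‖(PiLp.single 2 p a - PiLp.single 2 q a : PiLp 2 fun _ : Fin c => H)‖ ≤ √2 * r := by
  have hr : 0 ≤ r := (norm_nonneg a).trans ha
  rcases eq_or_ne p q with rfl | hpq
  · rw [sub_self, norm_zero]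
    positivity
  · refine abs_le_of_sq_le_sq' ?_ (by positivity) |>.2
    rw [norm_sub_sq_real, inner_single_right, PiLp.single_eq_of_ne 2 hpq.symm, inner_zero_left,
      PiLp.norm_single, PiLp.norm_single, mul_pow, Real.sq_sqrt zero_le_two]
    have := pow_le_pow_left₀ (norm_nonneg a) ha 2
    linarith

lemma surrogateRankingLoss_increment_le {ℓ : ℝ → ℝ} {ρ : ℝ≥0} (hℓ : LipschitzWith ρ ℓ)
    (hc : 0 < c) {φ : X → H} {r : ℝ} (hφ : ∀ x, ‖φ x‖ ≤ r) (x : X) (y : Labels c) :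
    ∃ (wt : Fin c × Fin c → ℝ) (u : Fin c × Fin c → PiLp 2 fun _ : Fin c => H),
      (∀ s, 0 ≤ wt s) ∧ ∑ s, wt s = 1 ∧ (∀ s, ‖u s‖ ≤ ρ * (√2 * r)) ∧
      ∀ w w' : PiLp 2 fun _ : Fin c => H,
        surrogateRankingLoss ℓ (linearScore φ w x) y -
            surrogateRankingLoss ℓ (linearScore φ w' x) y ≤
          ∑ s, wt s * |inner ℝ w (u s) - inner ℝ w' (u s)| := by
  have hr : 0 ≤ r := (norm_nonneg _).trans (hφ x)
  obtain ⟨wt, hwt, hwt1, hF⟩ := pairAverage_eq_sum y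
  rcases Nat.eq_zero_or_pos ((relevant y).card * (irrelevant y).card) with h0 | h0
  · have hz : ∀ F, pairAverage y F = 0 := fun F => by
      have : ((relevant y).card : ℝ) * (irrelevant y).card = 0 := by exact_mod_cast h0
      rw [pairAverage, this]
      simp
    -- With an empty class the loss vanishes; the weights must still sum to `1`, so all mass goes to
    -- an arbitrary pair.
    refine ⟨Pi.single (⟨0, hc⟩, ⟨0, hc⟩) 1, 0, fun s => ?_, by simp, fun s => ?_, fun w w' => ?_⟩
    · rw [Pi.single_apply]
      split_ifs <;> norm_num
    · simp only [Pi.zero_apply, norm_zero]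
      positivity
    · simp only [surrogateRankingLoss_eq_pairAverage, hz]
      simp
  · refine ⟨wt, fun s => (ρ : ℝ) • (PiLp.single 2 s.1 (φ x) - PiLp.single 2 s.2 (φ x)), hwt,
      hwt1 h0, fun s => ?_, fun w w' => ?_⟩
    · rw [norm_smul, Real.norm_of_nonneg ρ.coe_nonneg]
      exact mul_le_mul_of_nonneg_left (norm_single_sub_single_le _ _ (hφ x)) ρ.coe_nonneg
    · rw [surrogateRankingLoss_eq_pairAverage, surrogateRankingLoss_eq_pairAverage, hF, hF,
        ← Finset.sum_sub_distrib]
      refine Finset.sum_le_sum fun s _ => ?_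
      rw [← mul_sub]
      refine mul_le_mul_of_nonneg_left ?_ (hwt s)
      have h := hℓ.dist_le_mul (linearScore φ w x s.1 - linearScore φ w x s.2)
        (linearScore φ w' x s.1 - linearScore φ w' x s.2)
      rw [Real.dist_eq, Real.dist_eq] at h
      refine (le_abs_self _).trans (h.trans (le_of_eq ?_))
      simp only [real_inner_smul_right, inner_sub_right, inner_single_right]
      rw [← mul_sub, abs_mul, NNReal.abs_eq]
      rfl

/-- The scores with weights in a ball are limits of the scores with weights from a sequence. -/
lemma exists_seq_dense_weights [CompleteSpace H] [MeasurableSpace X] {φ : X → H}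
    (hφ : StronglyMeasurable φ) {Λ : ℝ} (hΛ : 0 ≤ Λ) :
    ∃ w : ℕ → PiLp 2 fun _ : Fin c => H, (∀ k, ‖w k‖ ≤ Λ) ∧
      ∀ f ∈ hypothesisSet c φ Λ, ∃ w' : PiLp 2 fun _ : Fin c => H,
        f = linearScore φ w' ∧ w' ∈ closure (Set.range w) := by
  -- `H` need not be separable, but strong measurability makes the range of `φ`, hence its closed
  -- span, separable.
  set M : Submodule ℝ H := (Submodule.span ℝ (Set.range φ)).topologicalClosure with hM
  have hMs : TopologicalSpace.IsSeparable (M : Set H) :=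
    (hφ.isSeparable_range.span (R := ℝ)).closure
  have hφM : ∀ x, φ x ∈ M := fun x =>
    Submodule.le_topologicalClosure _ (Submodule.subset_span ⟨x, rfl⟩)
  set K : Set (PiLp 2 fun _ : Fin c => H) := {w | ‖w‖ ≤ Λ ∧ ∀ j, w j ∈ M} with hK
  have hKs : TopologicalSpace.IsSeparable K := by
    refine ((TopologicalSpace.IsSeparable.univ_pi fun _ : Fin c => hMs).image
      (PiLp.continuous_toLp 2 fun _ : Fin c => H)).mono ?_
    rintro w ⟨-, hw⟩
    exact ⟨w.ofLp, fun j _ => hw j, rfl⟩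
  obtain ⟨t, htK, htc, hKt⟩ := hKs.exists_countable_dense_subset
  have h0K : (0 : PiLp 2 fun _ : Fin c => H) ∈ K := ⟨by simpa using hΛ, fun j => by simp⟩
  have htne : t.Nonempty := closure_nonempty_iff.1 ⟨0, hKt h0K⟩
  obtain ⟨w, rfl⟩ := htc.exists_eq_range htne
  refine ⟨w, fun k => (htK ⟨k, rfl⟩).1, fun f hf => ?_⟩
  obtain ⟨v, hv, rfl⟩ := exists_eq_linearScore hf
  -- Projecting the weights onto `M` keeps all scores, since `φ x ∈ M`, and does not increase the
  -- norm.
  refine ⟨WithLp.toLp 2 fun j => M.starProjection (v j), ?_, hKt ⟨?_, fun j => ?_⟩⟩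
  · funext x j
    simp only [linearScore]
    rw [Submodule.inner_starProjection_left_eq_right,
      Submodule.starProjection_eq_self_iff.2 (hφM x)]
  · refine le_trans ?_ hv
    rw [PiLp.norm_eq_of_L2, PiLp.norm_eq_of_L2]
    gcongr with j
    exact M.norm_starProjection_apply_le (v j)
  · exact M.starProjection_apply_mem (v j)

end LinearScores

/-! ### Generalization bound and constants -/

section GeneralizationBound

variable {X H : Type*} [MeasurableSpace X] [NormedAddCommGroup H] [InnerProductSpace ℝ H] {c : ℕ}

/-- Expected and empirical risk of the surrogate loss pass to limits of bounded weights. -/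
lemma deviation_surrogate_le_of_mem_closure {D : Measure (X × Labels c)} [IsProbabilityMeasure D]
    {φ : X → H} (hφ : StronglyMeasurable φ) {ℓ : ℝ → ℝ} (hℓ : Continuous ℓ) {B Λ C : ℝ}
    (h0 : ∀ u, 0 ≤ ℓ u) (hB0 : 0 ≤ B)
    (hB : ∀ f ∈ hypothesisSet c φ Λ, ∀ x, ∀ p q : Fin c, ℓ (f x p - f x q) ≤ B)
    {n : ℕ} (S : Fin n → X × Labels c) {w : ℕ → PiLp 2 fun _ : Fin c => H} (hw : ∀ k, ‖w k‖ ≤ Λ)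
    (hC : ∀ k, deviation D
      (fun z => surrogateRankingLoss ℓ (linearScore φ (w k) z.1) z.2) S ≤ C)
    {w' : PiLp 2 fun _ : Fin c => H} (hw' : w' ∈ closure (Set.range w)) :
    deviation D (fun z => surrogateRankingLoss ℓ (linearScore φ w' z.1) z.2) S ≤ C := by
  obtain ⟨v, hv, hlim⟩ := mem_closure_iff_seq_limit.1 hw'
  choose k hk using hv
  have hpt : ∀ z : X × Labels c, Filter.Tendsto
      (fun m => surrogateRankingLoss ℓ (linearScore φ (v m) z.1) z.2) Filter.atTop
      (nhds (surrogateRankingLoss ℓ (linearScore φ w' z.1) z.2)) := fun z =>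
    (((continuous_surrogateRankingLoss hℓ z.2).comp (continuous_linearScore φ z.1)).tendsto
      w').comp hlim
  have hint : Filter.Tendsto
      (fun m => ∫ z, surrogateRankingLoss ℓ (linearScore φ (v m) z.1) z.2 ∂D) Filter.atTop
      (nhds (∫ z, surrogateRankingLoss ℓ (linearScore φ w' z.1) z.2 ∂D)) := by
    refine tendsto_integral_of_dominated_convergence (fun _ => B) (fun m => ?_)
      (integrable_const _) (fun m => ae_of_all _ fun z => ?_) (ae_of_all _ hpt)
    · rw [← hk m]
      exact (measurable_loss_comp (fun y => (continuous_surrogateRankingLoss hℓ y).measurable)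
        (measurable_of_mem_hypothesisSet hφ
          (linearScore_mem_hypothesisSet (hw (k m))))).aestronglyMeasurable
    · rw [surrogateRankingLoss_eq_pairAverage,
        Real.norm_of_nonneg (pairAverage_nonneg _ fun p q => h0 _), ← hk m]
      exact pairAverage_le _ hB0 fun p q =>
        hB _ (linearScore_mem_hypothesisSet (hw (k m))) _ p q
  refine le_of_tendsto' (tendsto_finsetSum _ fun i _ => hint.sub (hpt (S i))) fun m => ?_
  have := hC (k m)
  rw [hk m] at this
  exact this

/-- Uniform generalization bound for the surrogate ranking loss. -/
theorem exists_surrogate_generalization_event [CompleteSpace H] (hc : 0 < c) (n : ℕ)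
    (D : Measure (X × Labels c)) [IsProbabilityMeasure D]
    {φ : X → H} (hφ : StronglyMeasurable φ) {Λ r B : ℝ} {ρ : ℝ≥0} (hΛ : 0 ≤ Λ)
    (hφr : ∀ x, ‖φ x‖ ≤ r) {ℓ : ℝ → ℝ} (hℓρ : LipschitzWith ρ ℓ) (h0 : ∀ u, 0 ≤ ℓ u)
    (hB0 : 0 ≤ B) (hB : ∀ f ∈ hypothesisSet c φ Λ, ∀ x, ∀ p q : Fin c, ℓ (f x p - f x q) ≤ B)
    {ε : ℝ} (hε : 0 ≤ ε) :
    ∃ A : Set (Fin n → X × Labels c), MeasurableSet A ∧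
      ENNReal.ofReal (1 - Real.exp (-ε ^ 2 / (2 * (n * (B / 2) ^ 2)))) ≤
        Measure.pi (fun _ : Fin n => D) A ∧
      ∀ S ∈ A, ∀ f ∈ hypothesisSet c φ Λ,
        deviation D (fun z => surrogateRankingLoss ℓ (f z.1) z.2) S ≤
          Λ * √(n * (4 * (ρ * (√2 * r)) ^ 2)) + ε := by
  obtain ⟨w, hw, hdense⟩ := exists_seq_dense_weights (c := c) hφ hΛ
  set h : ℕ → X × Labels c → ℝ :=
    fun k z => surrogateRankingLoss ℓ (linearScore φ (w k) z.1) z.2 with hh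
  have hm : ∀ k, Measurable (h k) := fun k =>
    measurable_loss_comp (fun y => (continuous_surrogateRankingLoss hℓρ.continuous y).measurable)
      (measurable_of_mem_hypothesisSet hφ (linearScore_mem_hypothesisSet (hw k)))
  refine ⟨{S | ∀ k, deviation D (h k) S ≤ Λ * √(n * (4 * (ρ * (√2 * r)) ^ 2)) + ε}, ?_, ?_, ?_⟩
  · rw [Set.ofPred_forall]
    exact MeasurableSet.iInter fun k =>
      measurableSet_le (measurable_deviation D (hm k) n) measurable_const
  · refine ofReal_one_sub_le_measure_forall_deviation_le D (τ := Fin c × Fin c) hw hm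
      (fun k z => pairAverage_nonneg _ fun p q => h0 _)
      (fun k z => pairAverage_le _ hB0 fun p q =>
        hB _ (linearScore_mem_hypothesisSet (hw k)) _ p q) (fun z => ?_) n hε
    obtain ⟨wt, u, h1, h2, h3, h4⟩ := surrogateRankingLoss_increment_le hℓρ hc hφr z.1 z.2
    exact ⟨wt, u, h1, h2, h3, fun k l => h4 (w k) (w l)⟩
  · intro S hS f hf
    obtain ⟨w', rfl, hw'⟩ := hdense f hf
    exact deviation_surrogate_le_of_mem_closure hφ hℓρ.continuous h0 hB0 hB S hw hS hw'

lemma deviation_eq {D : Measure (X × Labels c)} {L : (Fin c → ℝ) → Labels c → ℝ}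
    {f : X → Fin c → ℝ} {n : ℕ} (hn : 0 < n) (S : Fin n → X × Labels c) :
    deviation D (fun z => L (f z.1) z.2) S =
      n * (expectedRisk D L f - empiricalRisk S L f) := by
  have : (n : ℝ) ≠ 0 := by exact_mod_cast hn.ne'
  rw [deviation, Finset.sum_sub_distrib, expectedRisk, empiricalRisk, mul_sub, ← mul_assoc,
    mul_one_div, div_self this, one_mul]
  simp

/-- The left side squared carries only `c ^ 2`; the claimed `c ^ 3` is slack, using `1 ≤ c`. -/
lemma complexity_term_le {c n : ℕ} (hc : 0 < c) (hn : 0 < n) (Λ r : ℝ) (ρ : ℝ≥0) :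
    (c : ℝ) * (Λ * √(n * (4 * (ρ * (√2 * r)) ^ 2)) / n) ≤
      2 * √2 * ρ * √((c : ℝ) ^ 3 * Λ ^ 2 * r ^ 2 / n) := by
  have hn' : (0 : ℝ) < n := by exact_mod_cast hn
  have hc1 : (1 : ℝ) ≤ c := by exact_mod_cast hc
  refine abs_le_of_sq_le_sq' ?_ (by positivity) |>.2
  have h2 : √2 ^ 2 = (2 : ℝ) := Real.sq_sqrt zero_le_two
  have h1 : ((c : ℝ) * (Λ * √(n * (4 * (ρ * (√2 * r)) ^ 2)) / n)) ^ 2 =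
      8 * ρ ^ 2 * (c ^ 2 * Λ ^ 2 * r ^ 2 / n) := by
    rw [mul_pow, div_pow, mul_pow, Real.sq_sqrt (by positivity), mul_pow (ρ : ℝ), mul_pow √2, h2]
    field_simp
    ring
  have h3 : (2 * √2 * ρ * √((c : ℝ) ^ 3 * Λ ^ 2 * r ^ 2 / n)) ^ 2 =
      8 * ρ ^ 2 * (c ^ 3 * Λ ^ 2 * r ^ 2 / n) := by
    rw [mul_pow, mul_pow, mul_pow, h2, Real.sq_sqrt (by positivity)]
    ring
  rw [h1, h3]
  gcongr
  norm_num

/-- The exponent is exactly `-9 * log (2 / δ)`. One use of McDiarmid suffices, so the factor `3` and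
the `2` in `2 / δ` leave room. -/
lemma exp_tail_le {n : ℕ} (hn : 0 < n) {B δ : ℝ} (hB : 0 < B) (hδ : 0 < δ) (hδ1 : δ ≤ 1) :
    Real.exp (-(n * (3 * B * √(Real.log (2 / δ) / (2 * n)))) ^ 2 / (2 * (n * (B / 2) ^ 2))) ≤
      δ := by
  have hn' : (0 : ℝ) < n := by exact_mod_cast hn
  have h2δ : 1 ≤ 2 / δ := by rw [le_div_iff₀ hδ]; linarith
  have hlog : 0 ≤ Real.log (2 / δ) := Real.log_nonneg h2δ
  have h : -(n * (3 * B * √(Real.log (2 / δ) / (2 * n)))) ^ 2 / (2 * (n * (B / 2) ^ 2)) =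
      -(9 * Real.log (2 / δ)) := by
    rw [mul_pow, mul_pow (3 * B), Real.sq_sqrt (by positivity)]
    field_simp
    ring
  rw [h]
  calc Real.exp (-(9 * Real.log (2 / δ))) ≤ Real.exp (-Real.log (2 / δ)) := by
        gcongr
        linarith
    _ = δ / 2 := by rw [Real.exp_neg, Real.exp_log (by positivity), inv_div]
    _ ≤ δ := by linarith

end GeneralizationBound

end MultiLabel

theorem mainTheorem8 {X : Type*} [MeasurableSpace X]
    {H : Type*} [NormedAddCommGroup H] [InnerProductSpace ℝ H] [CompleteSpace H]
    (c n : ℕ) (hn : 0 < n)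
    (D : Measure (X × MultiLabel.Labels c)) [IsProbabilityMeasure D]
    (κ : X → X → ℝ) (hκ : MultiLabel.IsPDSKernel κ)
    (φ : X → H) (hφ : MultiLabel.IsFeatureMap κ φ) (hφm : StronglyMeasurable φ)
    (Λ r B : ℝ) (ρ : ℝ≥0) (hr : 0 < r) (hκr : ∀ x, κ x x ≤ r ^ 2)
    (ℓ : ℝ → ℝ) (hℓ01 : ∀ u, (if u ≤ 0 then (1 : ℝ) else 0) ≤ ℓ u)
    (hℓρ : LipschitzWith ρ ℓ)
    (hℓB : ∀ f ∈ MultiLabel.hypothesisSet c φ Λ, ∀ x, ∀ p q : Fin c, ℓ (f x p - f x q) ≤ B)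
    (tstar : (Fin c → ℝ) → MultiLabel.Labels c → MultiLabel.Labels c)
    (htstar : MultiLabel.IsOracleThreshold tstar)
    (δ : ℝ) (hδ : 0 < δ) :
    (∀ f ∈ MultiLabel.hypothesisSet c φ Λ,
      Integrable (fun z : X × MultiLabel.Labels c =>
        MultiLabel.hammingLoss (tstar (f z.1) z.2) z.2) D ∧
      Integrable (fun z : X × MultiLabel.Labels c => MultiLabel.rankingLoss (f z.1) z.2) D) ∧
    ∃ A : Set (Fin n → X × MultiLabel.Labels c), MeasurableSet A ∧
      ENNReal.ofReal (1 - δ) ≤ Measure.pi (fun _ : Fin n => D) A ∧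
      ∀ S ∈ A, ∀ f ∈ MultiLabel.hypothesisSet c φ Λ,
        MultiLabel.expectedRisk D (fun v y => MultiLabel.hammingLoss (tstar v y) y) f
            ≤ (c : ℝ) * MultiLabel.expectedRisk D MultiLabel.rankingLoss f ∧
        (c : ℝ) * MultiLabel.expectedRisk D MultiLabel.rankingLoss f
            ≤ (c : ℝ) * MultiLabel.empiricalRisk S (MultiLabel.surrogateRankingLoss ℓ) f
              + 2 * Real.sqrt 2 * (ρ : ℝ) * Real.sqrt ((c : ℝ) ^ 3 * Λ ^ 2 * r ^ 2 / (n : ℝ))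
              + 3 * B * (c : ℝ) * Real.sqrt (Real.log (2 / δ) / (2 * (n : ℝ))) := by
  have hH : ∀ f ∈ MultiLabel.hypothesisSet c φ Λ, Integrable (fun z : X × MultiLabel.Labels c =>
      MultiLabel.hammingLoss (tstar (f z.1) z.2) z.2) D := fun f hf =>
    MultiLabel.integrable_loss_comp (L := fun v y => MultiLabel.hammingLoss (tstar v y) y)
      htstar.measurable_hammingLoss (MultiLabel.measurable_of_mem_hypothesisSet hφm hf)
      (fun _ _ => MultiLabel.hammingLoss_nonneg _ _) (fun _ _ => MultiLabel.hammingLoss_le_one _ _)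
  have hR : ∀ f ∈ MultiLabel.hypothesisSet c φ Λ, Integrable (fun z : X × MultiLabel.Labels c =>
      MultiLabel.rankingLoss (f z.1) z.2) D := fun f hf =>
    MultiLabel.integrable_loss_comp MultiLabel.measurable_rankingLoss
      (MultiLabel.measurable_of_mem_hypothesisSet hφm hf)
      (fun _ _ => MultiLabel.rankingLoss_nonneg _ _) (fun _ _ => MultiLabel.rankingLoss_le_one _ _)
  refine ⟨fun f hf => ⟨hH f hf, hR f hf⟩, ?_⟩
  have hfirst : ∀ f ∈ MultiLabel.hypothesisSet c φ Λ,
      MultiLabel.expectedRisk D (fun v y => MultiLabel.hammingLoss (tstar v y) y) f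
        ≤ (c : ℝ) * MultiLabel.expectedRisk D MultiLabel.rankingLoss f := fun f hf => by
    rw [MultiLabel.expectedRisk, MultiLabel.expectedRisk, ← integral_const_mul]
    exact integral_mono (hH f hf) ((hR f hf).const_mul _) fun z => htstar.hammingLoss_le _ _
  rcases Nat.eq_zero_or_pos c with rfl | hc
  · refine ⟨Set.univ, MeasurableSet.univ, ?_, fun S _ f hf => ⟨hfirst f hf, by simp⟩⟩
    rw [measure_univ]
    exact ENNReal.ofReal_le_one.2 (by linarith)
  -- For `Λ < 0` the hypothesis set is empty; for `1 ≤ δ` the empty event suffices.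
  rcases lt_or_ge Λ 0 with hΛ | hΛ
  · refine ⟨Set.univ, MeasurableSet.univ, ?_, fun S _ f hf => ?_⟩
    · rw [measure_univ]
      exact ENNReal.ofReal_le_one.2 (by linarith)
    · obtain ⟨W, hW, -⟩ := hf
      exact absurd (hΛ.trans_le (Real.sqrt_nonneg _)) (not_lt.2 hW)
  rcases le_or_gt 1 δ with hδ1 | hδ1
  · exact ⟨∅, MeasurableSet.empty, by simp [ENNReal.ofReal_of_nonpos (sub_nonpos.2 hδ1)], by simp⟩
  obtain ⟨z₀⟩ := nonempty_of_isProbabilityMeasure D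
  have hℓ0 : ∀ u, 0 ≤ ℓ u := fun u => le_trans (by split_ifs <;> norm_num) (hℓ01 u)
  -- Zero weights are admissible and give `1 ≤ ℓ 0 ≤ B`.
  have hB : 0 < B := by
    have h1 := hℓB _ (MultiLabel.linearScore_mem_hypothesisSet (c := c) (φ := φ) (w := 0)
      (by simpa using hΛ)) z₀.1 ⟨0, hc⟩ ⟨0, hc⟩
    have h2 := hℓ01 0
    rw [sub_self] at h1
    rw [if_pos le_rfl] at h2
    linarith
  have hφr : ∀ x, ‖φ x‖ ≤ r := fun x => by
    refine abs_le_of_sq_le_sq' ?_ hr.le |>.2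
    rw [← real_inner_self_eq_norm_sq, ← hφ]
    exact hκr x
  have hn' : (0 : ℝ) < n := by exact_mod_cast hn
  obtain ⟨A, hA, hAδ, hAS⟩ := MultiLabel.exists_surrogate_generalization_event hc n D hφm hΛ hφr
    hℓρ hℓ0 hB.le hℓB
    (ε := n * (3 * B * √(Real.log (2 / δ) / (2 * n)))) (by positivity)
  refine ⟨A, hA, le_trans (ENNReal.ofReal_le_ofReal ?_) hAδ, fun S hS f hf => ⟨hfirst f hf, ?_⟩⟩
  · linarith [MultiLabel.exp_tail_le hn hB hδ hδ1.le]
  have hdev := hAS S hS f hf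
  -- The deviation is a sum over the sample; division by `n` turns `ε` into `3 * B * √(log (2 / δ) /
  -- (2 * n))`.
  rw [MultiLabel.deviation_eq hn S, ← le_div_iff₀' hn', add_div, mul_div_cancel_left₀ _ hn'.ne']
    at hdev
  have hRS : MultiLabel.expectedRisk D MultiLabel.rankingLoss f ≤
      MultiLabel.expectedRisk D (MultiLabel.surrogateRankingLoss ℓ) f := by
    refine integral_mono (hR f hf) ?_ fun z =>
      MultiLabel.rankingLoss_le_surrogateRankingLoss hℓ01 _ _
    exact MultiLabel.integrable_loss_comp (B := B)
      (fun y => (MultiLabel.continuous_surrogateRankingLoss hℓρ.continuous y).measurable)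
      (MultiLabel.measurable_of_mem_hypothesisSet hφm hf)
      (fun x y => MultiLabel.pairAverage_nonneg y fun p q => hℓ0 _)
      (fun x y => MultiLabel.pairAverage_le y hB.le fun p q => hℓB f hf x p q)
  have hcomp := MultiLabel.complexity_term_le hc hn Λ r ρ
  have hmul := mul_le_mul_of_nonneg_left (hRS.trans (sub_le_iff_le_add'.1 hdev)) (Nat.cast_nonneg (α := ℝ) c)
  linarith
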